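/- Let $N\ge 1$ be an integer, and for $\Omega\subseteq\mathbb{R}^N$ open let $L^p(\Omega)$, $H^1_{\mathrm{loc}}(\Omega)$, $H^1_0(\Omega)$ denote spaces of complex-valued functions, where $H^1_0(\Omega)$ is the closure of $\mathscr{D}(\Omega)=C_c^\infty(\Omega;\mathbb{C})$ in $H^1(\Omega)$. Let $\mathbb{A}=\mathbb{C}\setminus\{z:\operatorname{Re}z=0,\ \operatorname{Im}z\le 0\}$ and $\mathbb{B}=\mathbb{A}\cup\{0\}$. For $0<m<1$, $a,b\in\mathbb{C}$ and $F\in L^1_{\mathrm{loc}}(\Omega)$, a global weak solution of $$-i\Delta u+a|u|^{-(1-m)}u+bu=F\ \text{ in }\Omega,\qquad u=0\ \text{ on }\partial\Omega,$$ is a function $u\in H^1_{\mathrm{loc}}(\Omega)$ which satisfies the equation in $\mathscr{D}'(\Omega)$ and belongs to $H^1_0(\Omega)\cap L^{m+1}(\Omega)$; here $|z|^{-(1-m)}z$ is understood to be $0$ at $z=0$. **Theorem 5.1.** For each integer $N\ge1$ and each $m\in(0,1)$ there is a constant $C=C(N,m)>0$, depending only on $N$ and $m$ and continuously on $m$, such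 that the following holds. Let $\Omega\subseteq\mathbb{R}^N$ be a nonempty open set, and let $(a,b)\in\mathbb{C}^2\setminus\{(0,0)\}$ satisfy $$\operatorname{Im}(a)\ge 0\quad\text{and}\quad\Big[\big(a\ne 0\text{ and }\operatorname{Re}(a\bar b)\ge 0\big)\ \text{ or }\ \big(a=0\text{ and }b\in\mathbb{B}\big)\Big].$$ Let $F_1,F_2\in L^1_{\mathrm{loc}}(\Omega)$ with $F_1-F_2\in L^2(\Omega)$, and let $u_1,u_2\in H^1_0(\Omega)\cap L^{m+1}(\Omega)$ be global weak solutions with sources $F_1$ and $F_2$, respectively (and the same $a,b,m$). 1. If $a\ne 0$ and $\operatorname{Re}(a\bar b)>0$, then $$\|u_1-u_2\|_{L^2(\Omega)}\le\frac{|a|}{\operatorname{Re}(a\bar b)}\,\|F_1-F_2\|_{L^2(\Omega)}.$$ 2. If $a=0$, then $$\|u_1-u_2\|_{L^2(\Omega)}\le\frac{1}{b_0}\,\|F_1-F_2\|_{L^2(\Omega)},$$ where $b_0=|\operatorname{Re}(b)|$ if $\operatorname{Re}(b)\ne 0$ and $b_0=\operatorname{Im}(b)$ if $\operatorname{Re}(b)=0$.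 3. If $a\ne 0$, $\operatorname{Re}(a\bar b)=0$ and moreover $u_1,u_2\in L^\infty(\Omega)$, then $$\|u_1-u_2\|_{L^2(\Omega)}\le C\,\frac{\big(\|u_1\|_{L^\infty(\Omega)}+\|u_2\|_{L^\infty(\Omega)}\big)^{1-m}}{|a|}\,\|F_1-F_2\|_{L^2(\Omega)}.$$ -/

import Mathlib

open MeasureTheory TopologicalSpace
open scoped Distributions ENNReal ComplexConjugate

noncomputable section

namespace StationaryNLS

/-- Euclidean space `ℝ^N`. -/
abbrev Space (N : ℕ) : Type := EuclideanSpace ℝ (Fin N)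

variable {N : ℕ}

/-- The classical partial derivative `∂_j f`. -/
def partialDeriv (j : Fin N) (f : Space N → ℂ) (x : Space N) : ℂ :=
  fderiv ℝ f x (EuclideanSpace.single j 1)

/-- Membership in `L^p(Ω; ℂ)` for Lebesgue measure. -/
def MemLpOn (Ω : Opens (Space N)) (p : ℝ≥0∞) (f : Space N → ℂ) : Prop :=
  MemLp f p (volume.restrict (Ω : Set (Space N)))

/-- Membership in `L^p_loc(Ω; ℂ)`: the function is in `L^p(K)` for each compact `K ⊆ Ω`. -/
def MemLpLocOn (Ω : Opens (Space N)) (p : ℝ≥0∞) (f : Space N → ℂ) : Prop :=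
  ∀ K : Set (Space N), IsCompact K → K ⊆ Ω → MemLp f p (volume.restrict K)

/-- The real number `‖f‖_{L^p(Ω)}`; it is only used for `f ∈ L^p(Ω)`. -/
def normLpOn (Ω : Opens (Space N)) (p : ℝ≥0∞) (f : Space N → ℂ) : ℝ :=
  lpNorm f p (volume.restrict (Ω : Set (Space N)))

/-- `g` is the weak partial derivative `∂_j u` in `Ω`:
`∫_Ω u ∂_jφ = - ∫_Ω g φ` for every test function `φ ∈ 𝓓(Ω; ℂ)`. -/
def HasWeakPartial (Ω : Opens (Space N)) (j : Fin N) (u g : Space N → ℂ) : Prop :=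
  ∀ φ : 𝓓(Ω, ℂ),
    ∫ x in (Ω : Set (Space N)), u x * partialDeriv j φ x =
      -∫ x in (Ω : Set (Space N)), g x * φ x

/-- `u ∈ H^1_loc(Ω; ℂ)`. -/
def MemH1Loc (Ω : Opens (Space N)) (u : Space N → ℂ) : Prop :=
  MemLpLocOn Ω 2 u ∧
    ∃ G : Fin N → Space N → ℂ, ∀ j, MemLpLocOn Ω 2 (G j) ∧ HasWeakPartial Ω j u (G j)

/-- `u ∈ H^1_0(Ω; ℂ)`, the closure of `𝓓(Ω; ℂ)` in `H^1(Ω; ℂ)`: `u` and its weak gradient are in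
`L²(Ω)`, and there are test functions arbitrarily close to `u` in `L²(Ω)` whose gradients are at the
same time arbitrarily close in `L²(Ω)` to the weak gradient of `u`. -/
def MemH10 (Ω : Opens (Space N)) (u : Space N → ℂ) : Prop :=
  MemLpOn Ω 2 u ∧
    ∃ G : Fin N → Space N → ℂ, (∀ j, MemLpOn Ω 2 (G j) ∧ HasWeakPartial Ω j u (G j)) ∧
      ∀ ε : ℝ, 0 < ε → ∃ φ : 𝓓(Ω, ℂ),
        normLpOn Ω 2 (fun x => u x - φ x) ≤ ε ∧
          ∀ j, normLpOn Ω 2 (fun x => G j x - partialDeriv j φ x) ≤ ε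

/-- The singular nonlinearity `|z|^{-(1-m)} z`. Its value at `z = 0` is `0`. -/
def singularPower (m : ℝ) (z : ℂ) : ℂ := ((‖z‖ ^ (-(1 - m)) : ℝ) : ℂ) * z

/-- `u` is a local weak solution of `-iΔu + a|u|^{-(1-m)}u + bu = F` in `Ω`: `u ∈ H^1_loc(Ω)` and
the equation holds in `𝓓'(Ω)`. The pairing is `⟨T, φ⟩ = Re ∫_Ω T φ̄` for locally integrable `T`, and
`⟨-iΔu, φ⟩ = ⟨-iu, Δφ⟩`. -/
def IsLocalWeakSolution (Ω : Opens (Space N)) (m : ℝ) (a b : ℂ) (F u : Space N → ℂ) : Prop :=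
  MemH1Loc Ω u ∧
    ∀ φ : 𝓓(Ω, ℂ),
      (∫ x in (Ω : Set (Space N)),
          (-Complex.I * u x * conj (Laplacian.laplacian (φ : Space N → ℂ) x) +
            (a * singularPower m (u x) + b * u x) * conj (φ x))).re =
        (∫ x in (Ω : Set (Space N)), F x * conj (φ x)).re

/-- `u` is a global weak solution of `-iΔu + a|u|^{-(1-m)}u + bu = F` in `Ω` with the Dirichlet
condition `u = 0` on `∂Ω`: a local weak solution in `H^1_0(Ω) ∩ L^{m+1}(Ω)`. -/
def IsGlobalWeakSolution (Ω : Opens (Space N)) (m : ℝ) (a b : ℂ) (F u : Space N → ℂ) : Prop :=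
  IsLocalWeakSolution Ω m a b F u ∧ MemH10 Ω u ∧ MemLpOn Ω (ENNReal.ofReal (m + 1)) u

/-- The set `𝔸`: the complex plane without the closed half-line of the numbers `z` with `Re z = 0`
and `Im z ≤ 0`. -/
def setA : Set ℂ := {z : ℂ | z.re = 0 ∧ z.im ≤ 0}ᶜ

/-- The set `𝔹 = 𝔸 ∪ {0}`. -/
def setB : Set ℂ := setA ∪ {0}

/-- The assumption on the coefficients `(a, b)` used for uniqueness. -/
def UniquenessAssumption (a b : ℂ) : Prop :=
  0 ≤ a.im ∧ ((a ≠ 0 ∧ 0 ≤ (a * conj b).re) ∨ (a = 0 ∧ b ∈ setB))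

/-- `b₀ = |Re b|` if `Re b ≠ 0`, and `b₀ = Im b` if `Re b = 0`. -/
def bZero (b : ℂ) : ℝ := if b.re ≠ 0 then |b.re| else b.im

end StationaryNLS

end

/-!
The difference `u = u₁ - u₂` solves `-iΔu + K = F`, where `K` is the difference of the zero-order
terms and `F = F₁ - F₂`. Pairing with `c ū` for a constant `c` with `Im c ≤ 0` and taking real parts
gives `Re (ci) ∫ |∇u|² + Re (c ∫ K ū) = Re (c ∫ F ū)`, whose gradient term is nonnegative, so a
pointwise bound `δ |u|² ≤ Re (c K ū)` yields `δ ‖u‖ ≤ ‖c‖ ‖F‖`. Since the singular part of `K` is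
bounded by `1 + |u₁|` and `1 + |u₂|`, it is only square integrable on bounded sets, and the pairing
is justified by testing with `χ u` and letting the cutoff `χ` increase to `1`.

For `c = ā` the pointwise bound is the monotonicity of `z ↦ |z|^(m-1) z`. Its quantitative form
`m |z - w|² ≤ (|z| + |w|)^(1-m) Re ((|z|^(m-1) z - |w|^(m-1) w) (z̄ - w̄))` comes from splitting the
inner product into a radial part, where it is the concavity of `r ↦ r^m`, and an angular part, whose
weight `(|z|^(m-1) + |w|^(m-1)) / 2` is at least `(|z| + |w|)^(m-1)`; it makes `C = 1 / m`
admissible for bounded solutions.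
-/

namespace StationaryNLS

open Filter Topology
open scoped ContDiff RealInnerProductSpace

section Monotonicity

theorem mul_sub_sq_le_rpow_mul {m r s : ℝ} (hm0 : 0 ≤ m) (hm1 : m ≤ 1) (hr : 0 ≤ r)
    (hs : 0 ≤ s) :
    m * (r - s) ^ 2 ≤ (r + s) ^ (1 - m) * ((r ^ m - s ^ m) * (r - s)) := by
  wlog hsr : s ≤ r generalizing r s
  · convert this hs hr (le_of_not_ge hsr) using 1 <;> ring_nf
  have hpow : s ^ m ≤ r ^ m := Real.rpow_le_rpow hs hsr hm0
  have htangent : m * (r - s) ≤ r ^ (1 - m) * (r ^ m - s ^ m) := by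
    have hsplit : r ^ (1 - m) * r ^ m = r := by
      rw [← Real.rpow_add' hr (by simp), sub_add_cancel, Real.rpow_one]
    have hyoung := Real.geom_mean_le_arith_mean2_weighted (sub_nonneg.2 hm1) hm0 hr hs
      (sub_add_cancel 1 m)
    linarith
  calc m * (r - s) ^ 2 = m * (r - s) * (r - s) := by ring
    _ ≤ (r + s) ^ (1 - m) * (r ^ m - s ^ m) * (r - s) := by
        refine mul_le_mul_of_nonneg_right (htangent.trans ?_) (sub_nonneg.2 hsr)
        exact mul_le_mul_of_nonneg_right
          (Real.rpow_le_rpow hr (le_add_of_nonneg_right hs) (sub_nonneg.2 hm1))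
          (sub_nonneg.2 hpow)
    _ = _ := mul_assoc _ _ _

variable {E : Type*} [NormedAddCommGroup E] [InnerProductSpace ℝ E]

theorem inner_smul_sub_smul_sub (α β : ℝ) (x y : E) :
    ⟪α • x - β • y, x - y⟫ = (α + β) / 2 * (‖x - y‖ ^ 2 - (‖x‖ - ‖y‖) ^ 2) +
      (α * ‖x‖ - β * ‖y‖) * (‖x‖ - ‖y‖) := by
  rw [norm_sub_sq_real]
  simp only [inner_sub_left, inner_sub_right, real_inner_smul_left, real_inner_self_eq_norm_sq,
    real_inner_comm x y]
  ring

theorem mul_norm_sub_sq_le_inner_rpow_smul {m : ℝ} (hm0 : 0 < m) (hm1 : m ≤ 1) (x y : E) :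
    m * ‖x - y‖ ^ 2 ≤ (‖x‖ + ‖y‖) ^ (1 - m) *
      ⟪‖x‖ ^ (-(1 - m)) • x - ‖y‖ ^ (-(1 - m)) • y, x - y⟫ := by
  have hpow (z : E) : ‖z‖ ^ (-(1 - m)) * ‖z‖ = ‖z‖ ^ m := by
    rcases eq_or_ne z 0 with rfl | hz
    · simp [Real.zero_rpow hm0.ne']
    · rw [← Real.rpow_add_one (norm_ne_zero_iff.2 hz)]
      congr 1
      ring
  have hradial := mul_sub_sq_le_rpow_mul hm0.le hm1 (norm_nonneg x) (norm_nonneg y)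
  have hangular : m * (‖x - y‖ ^ 2 - (‖x‖ - ‖y‖) ^ 2) ≤ (‖x‖ + ‖y‖) ^ (1 - m) *
      ((‖x‖ ^ (-(1 - m)) + ‖y‖ ^ (-(1 - m))) / 2 * (‖x - y‖ ^ 2 - (‖x‖ - ‖y‖) ^ 2)) := by
    rcases eq_or_ne x 0 with rfl | hx
    · simp
    rcases eq_or_ne y 0 with rfl | hy
    · simp
    have hone (z : E) (hz : z ≠ 0) (hle : ‖z‖ ≤ ‖x‖ + ‖y‖) :
        1 ≤ (‖x‖ + ‖y‖) ^ (1 - m) * ‖z‖ ^ (-(1 - m)) := by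
      have hz' := norm_pos_iff.2 hz
      rw [Real.rpow_neg hz'.le, ← div_eq_mul_inv, one_le_div (by positivity)]
      exact Real.rpow_le_rpow hz'.le hle (sub_nonneg.2 hm1)
    rw [← mul_assoc]
    refine mul_le_mul_of_nonneg_right ?_
      (sub_nonneg.2 (sq_le_sq.2 ((abs_norm_sub_norm_le x y).trans (le_abs_self _))))
    linarith [hone x hx (by simp), hone y hy (by simp)]
  rw [inner_smul_sub_smul_sub, hpow, hpow]
  linarith

theorem mul_norm_sub_sq_le_singularPower {m : ℝ} (hm0 : 0 < m) (hm1 : m ≤ 1) (z w : ℂ) :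
    m * ‖z - w‖ ^ 2 ≤ (‖z‖ + ‖w‖) ^ (1 - m) *
      ((singularPower m z - singularPower m w) * conj (z - w)).re := by
  have h := mul_norm_sub_sq_le_inner_rpow_smul hm0 hm1 z w
  rwa [real_inner_comm, Complex.inner] at h

theorem re_singularPower_sub_mul_conj_nonneg {m : ℝ} (hm0 : 0 < m) (hm1 : m ≤ 1) (z w : ℂ) :
    0 ≤ ((singularPower m z - singularPower m w) * conj (z - w)).re := by
  rcases eq_or_ne z w with rfl | hzw
  · simp
  have hpos : 0 < m * ‖z - w‖ ^ 2 := mul_pos hm0 (pow_pos (norm_pos_iff.2 (sub_ne_zero.2 hzw)) 2)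
  exact (pos_of_mul_pos_right (hpos.trans_le (mul_norm_sub_sq_le_singularPower hm0 hm1 z w))
    (by positivity)).le

theorem norm_singularPower_le {m : ℝ} (hm0 : 0 ≤ m) (hm1 : m ≤ 1) (z : ℂ) :
    ‖singularPower m z‖ ≤ 1 + ‖z‖ := by
  rcases eq_or_ne z 0 with rfl | hz
  · simp [singularPower]
  have hnorm : ‖singularPower m z‖ = ‖z‖ ^ m := by
    rw [singularPower, norm_mul, Complex.norm_real, Real.norm_of_nonneg (by positivity),
      ← Real.rpow_add_one (norm_ne_zero_iff.2 hz)]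
    congr 1
    ring
  have hyoung := Real.geom_mean_le_arith_mean2_weighted (sub_nonneg.2 hm1) hm0 zero_le_one
    (norm_nonneg z) (sub_add_cancel 1 m)
  rw [Real.one_rpow, one_mul] at hyoung
  rw [hnorm]
  nlinarith [norm_nonneg z]

theorem measurable_singularPower (m : ℝ) : Measurable (singularPower m) := by
  unfold singularPower
  fun_prop

theorem memLp_singularPower {α : Type*} [MeasurableSpace α] {μ : Measure α} [IsFiniteMeasure μ]
    {m : ℝ} (hm0 : 0 ≤ m) (hm1 : m ≤ 1) {p : ℝ≥0∞} {u : α → ℂ} (hu : MemLp u p μ) :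
    MemLp (fun x => singularPower m (u x)) p μ :=
  ((memLp_const (1 : ℝ)).add hu.norm).mono
    ((measurable_singularPower m).comp_aemeasurable hu.1.aemeasurable).aestronglyMeasurable
    (ae_of_all _ fun x => (norm_singularPower_le hm0 hm1 (u x)).trans (le_abs_self _))

end Monotonicity

section SquareIntegrable

variable {α : Type*} [MeasurableSpace α] {μ : Measure α}

theorem integral_norm_sq_eq_lpNorm_sq {E : Type*} [NormedAddCommGroup E] {f : α → E}
    (hf : MemLp f 2 μ) : ∫ x, ‖f x‖ ^ 2 ∂μ = lpNorm f 2 μ ^ 2 := by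
  rw [lpNorm_eq_integral_norm_rpow_toReal (by norm_num) (by norm_num) hf.1,
    ← Real.rpow_natCast, ← Real.rpow_mul (integral_nonneg fun x => by positivity)]
  simp

theorem norm_integral_mul_le {f g : α → ℂ} (hf : MemLp f 2 μ) (hg : MemLp g 2 μ) :
    ‖∫ x, f x * g x ∂μ‖ ≤ lpNorm f 2 μ * lpNorm g 2 μ := by
  calc ‖∫ x, f x * g x ∂μ‖ ≤ ∫ x, ‖f x‖ * ‖g x‖ ∂μ := by
        simpa only [norm_mul] using norm_integral_le_integral_norm (fun x => f x * g x)
    _ ≤ (∫ x, ‖f x‖ ^ (2 : ℝ) ∂μ) ^ (1 / (2 : ℝ)) * (∫ x, ‖g x‖ ^ (2 : ℝ) ∂μ) ^ (1 / (2 : ℝ)) :=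
        integral_mul_norm_le_Lp_mul_Lq Real.HolderConjugate.two_two (by simpa using hf)
          (by simpa using hg)
    _ = lpNorm f 2 μ * lpNorm g 2 μ := by
        rw [lpNorm_eq_integral_norm_rpow_toReal (by norm_num) (by norm_num) hf.1,
          lpNorm_eq_integral_norm_rpow_toReal (by norm_num) (by norm_num) hg.1]
        simp

theorem memLp_conj {p : ℝ≥0∞} {f : α → ℂ} (hf : MemLp f p μ) :
    MemLp (fun x => conj (f x)) p μ :=
  hf.of_le (Complex.continuous_conj.comp_aestronglyMeasurable hf.1) (by simp)

theorem integrable_mul_of_memLp_two {f g : α → ℂ} (hf : MemLp f 2 μ) (hg : MemLp g 2 μ) :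
    Integrable (fun x => f x * g x) μ :=
  hf.integrable_mul hg

theorem integrable_mul_conj {f g : α → ℂ} (hf : MemLp f 2 μ) (hg : MemLp g 2 μ) :
    Integrable (fun x => f x * conj (g x)) μ :=
  hf.integrable_mul (memLp_conj hg)

theorem norm_integral_mul_conj_le {f g : α → ℂ} (hf : MemLp f 2 μ) (hg : MemLp g 2 μ) :
    ‖∫ x, f x * conj (g x) ∂μ‖ ≤ lpNorm f 2 μ * lpNorm g 2 μ :=
  (norm_integral_mul_le hf (memLp_conj hg)).trans_eq (congrArg _ (lpNorm_conj g 2 μ))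

theorem tendsto_integral_mul_conj {f u : α → ℂ} {v : ℕ → α → ℂ} (hf : MemLp f 2 μ)
    (hu : MemLp u 2 μ) (hv : ∀ n, MemLp (v n) 2 μ)
    (h : Tendsto (fun n => lpNorm (fun x => u x - v n x) 2 μ) atTop (𝓝 0)) :
    Tendsto (fun n => ∫ x, f x * conj (v n x) ∂μ) atTop (𝓝 (∫ x, f x * conj (u x) ∂μ)) := by
  rw [tendsto_iff_norm_sub_tendsto_zero]
  refine squeeze_zero (fun n => norm_nonneg _) (fun n => ?_)
    (by simpa only [mul_zero] using h.const_mul (lpNorm f 2 μ))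
  rw [norm_sub_rev, ← integral_sub (integrable_mul_conj hf hu) (integrable_mul_conj hf (hv n))]
  simp only [← mul_sub, ← map_sub]
  exact norm_integral_mul_conj_le hf (hu.sub (hv n))

end SquareIntegrable

section Multiplier

variable {α E : Type*} [MeasurableSpace α] {μ : Measure α} [NormedAddCommGroup E]
  [NormedSpace ℝ E] {f : α → E}

theorem tendsto_integral_smul_of_tendsto {η : ℕ → α → ℝ} {C k : ℝ} (hf : Integrable f μ)
    (hη : ∀ n, AEStronglyMeasurable (η n) μ) (hC : ∀ n x, ‖η n x‖ ≤ C)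
    (hk : ∀ x, Tendsto (fun n => η n x) atTop (𝓝 k)) :
    Tendsto (fun n => ∫ x, η n x • f x ∂μ) atTop (𝓝 (k • ∫ x, f x ∂μ)) := by
  rw [← integral_smul]
  refine tendsto_integral_of_dominated_convergence (fun x => C * ‖f x‖)
    (fun n => (hη n).smul hf.1) (hf.norm.const_mul C) (fun n => ae_of_all _ fun x => ?_)
    (ae_of_all _ fun x => (hk x).smul_const (f x))
  rw [norm_smul]
  exact mul_le_mul_of_nonneg_right (hC n x) (norm_nonneg _)

theorem memLp_smul_of_restrict_tsupport [TopologicalSpace α] [BorelSpace α] {p : ℝ≥0∞}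
    {χ : α → ℝ} (hχ : Continuous χ) (hχc : HasCompactSupport χ)
    (hf : MemLp f p (μ.restrict (tsupport χ))) : MemLp (fun x => χ x • f x) p μ := by
  obtain ⟨C, hC⟩ := hχ.bounded_above_of_compact_support hχc
  have hmeas : MeasurableSet (tsupport χ) := (isClosed_tsupport χ).measurableSet
  have hsupp : (tsupport χ).indicator (fun x => χ x • f x) = fun x => χ x • f x :=
    Set.indicator_eq_self.2 ((Function.support_smul_subset_left _ _).trans (subset_tsupport χ))
  rw [← hsupp, memLp_indicator_iff_restrict hmeas]
  exact hf.of_le_mul (hχ.measurable.aestronglyMeasurable.smul hf.1)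
    (ae_of_all _ fun x => by
      rw [norm_smul]
      exact mul_le_mul_of_nonneg_right (hC x) (norm_nonneg _))

end Multiplier

section Cutoff

variable (E : Type*) [NormedAddCommGroup E] [NormedSpace ℝ E] [FiniteDimensional ℝ E]

theorem exists_cutoff_seq : ∃ (χ : ℕ → E → ℝ) (C : ℝ),
    (∀ n, ContDiff ℝ ∞ (χ n)) ∧ (∀ n, HasCompactSupport (χ n)) ∧
    (∀ n x, χ n x ∈ Set.Icc 0 1) ∧ (∀ n x, ‖fderiv ℝ (χ n) x‖ ≤ C) ∧
    ∀ x, ∀ᶠ n in atTop, χ n =ᶠ[𝓝 x] 1 := by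
  let η : ContDiffBump (0 : E) := ⟨1, 2, one_pos, one_lt_two⟩
  have hη : ContDiff ℝ ∞ η := η.contDiff
  have hpos (n : ℕ) : (0 : ℝ) < ((n : ℝ) + 1)⁻¹ := by positivity
  obtain ⟨C, hC⟩ := (hη.continuous_fderiv (by simp)).bounded_above_of_compact_support
    (η.hasCompactSupport.fderiv ℝ)
  refine ⟨fun n x => η (((n : ℝ) + 1)⁻¹ • x), C, fun n => hη.comp (contDiff_const_smul _),
    fun n => η.hasCompactSupport.comp_smul (hpos n).ne', fun n x => ⟨η.nonneg, η.le_one⟩,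
    fun n x => ?_, fun x => ?_⟩
  · have hle : ((n : ℝ) + 1)⁻¹ ≤ 1 := inv_le_one_of_one_le₀ (by simp)
    rw [fderiv_comp_smul (f := η), norm_smul, Real.norm_of_nonneg (hpos n).le]
    exact (mul_le_mul hle (hC _) (norm_nonneg _) zero_le_one).trans_eq (one_mul C)
  · have hlim : Tendsto (fun n : ℕ => ((n : ℝ) + 1)⁻¹ • x) atTop (𝓝 0) := by
      simpa only [one_div, zero_smul] using
        (tendsto_one_div_add_atTop_nhds_zero_nat (𝕜 := ℝ)).smul_const x
    filter_upwards [hlim.eventually (Metric.ball_mem_nhds 0 one_pos)] with n hn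
    exact (continuous_const_smul (((n : ℝ) + 1)⁻¹)).continuousAt.eventually
      (η.eventuallyEq_one_of_mem_ball hn)

end Cutoff

variable {N : ℕ} {Ω : Opens (Space N)}

section TestFunctions

/-- The partial derivative `∂_j` as an operator on test functions. -/
noncomputable def partialTest (j : Fin N) : 𝓓(Ω, ℂ) →L[ℂ] 𝓓(Ω, ℂ) :=
  TestFunction.lineDerivCLM ℂ (EuclideanSpace.single j 1)

@[simp]
theorem coe_partialTest (j : Fin N) (φ : 𝓓(Ω, ℂ)) : ⇑(partialTest j φ) = partialDeriv j φ := by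
  ext x
  rw [partialTest, TestFunction.lineDerivCLM_eq_fderivCLM,
    TestFunction.fderivCLM_apply_of_le φ le_rfl]
  rfl

/-- Complex conjugation as an operator on test functions. -/
noncomputable def conjTest : 𝓓(Ω, ℂ) →L[ℝ] 𝓓(Ω, ℂ) :=
  TestFunction.postcompCLM (Complex.conjCLE : ℂ →L[ℝ] ℂ)

@[simp]
theorem coe_conjTest (φ : 𝓓(Ω, ℂ)) : ⇑(conjTest φ) = fun x => conj (φ x) := rfl

/-- The product of a smooth real function and a test function. -/
noncomputable def smulTest (χ : Space N → ℝ) (hχ : ContDiff ℝ ∞ χ) (φ : 𝓓(Ω, ℂ)) : 𝓓(Ω, ℂ) where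
  toFun x := χ x • φ x
  contDiff' := hχ.smul φ.contDiff
  hasCompactSupport' := φ.hasCompactSupport.smul_left (f := χ)
  tsupport_subset' := (tsupport_smul_subset_right χ φ).trans φ.tsupport_subset

@[simp]
theorem coe_smulTest (χ : Space N → ℝ) (hχ : ContDiff ℝ ∞ χ) (φ : 𝓓(Ω, ℂ)) :
    ⇑(smulTest χ hχ φ) = fun x => χ x • φ x := rfl

theorem partialDeriv_sub_test (j : Fin N) (φ ψ : 𝓓(Ω, ℂ)) (x : Space N) :
    partialDeriv j (φ - ψ : 𝓓(Ω, ℂ)) x = partialDeriv j φ x - partialDeriv j ψ x := by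
  simp only [← coe_partialTest, map_sub, sub_apply]

theorem partialDeriv_const_smul_test (j : Fin N) (c : ℂ) (φ : 𝓓(Ω, ℂ)) (x : Space N) :
    partialDeriv j (c • φ : 𝓓(Ω, ℂ)) x = c * partialDeriv j φ x := by
  simp only [← coe_partialTest, map_smul, smul_apply, smul_eq_mul]

theorem partialDeriv_conj (j : Fin N) (f : Space N → ℂ) (x : Space N) :
    partialDeriv j (fun y => conj (f y)) x = conj (partialDeriv j f x) := by
  have h : fderiv ℝ (fun y => conj (f y)) x =
      Complex.conjCLE.toContinuousLinearMap ∘L fderiv ℝ f x := Complex.conjCLE.comp_fderiv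
  simp only [partialDeriv, h]
  rfl

theorem partialDeriv_smul {χ : Space N → ℝ} {f : Space N → ℂ} {x : Space N} (j : Fin N)
    (hχ : DifferentiableAt ℝ χ x) (hf : DifferentiableAt ℝ f x) :
    partialDeriv j (fun y => χ y • f y) x =
      χ x • partialDeriv j f x + fderiv ℝ χ x (EuclideanSpace.single j 1) • f x := by
  rw [partialDeriv, fderiv_fun_smul hχ hf]
  rfl

theorem laplacian_eq_sum_partialDeriv {f : Space N → ℂ} (hf : ContDiff ℝ 2 f) (x : Space N) :
    Laplacian.laplacian f x = ∑ j, partialDeriv j (partialDeriv j f) x := by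
  rw [InnerProductSpace.laplacian_eq_iteratedFDeriv_orthonormalBasis f
    (EuclideanSpace.basisFun (Fin N) ℝ)]
  refine Finset.sum_congr rfl fun j _ => ?_
  have hd : DifferentiableAt ℝ (fderiv ℝ f) x :=
    (hf.fderiv_right (m := 1) (by norm_num)).differentiable (by simp) x
  have h : fderiv ℝ (partialDeriv j f) x =
      (fderiv ℝ (fderiv ℝ f) x).flip (EuclideanSpace.single j 1) := by
    have h := fderiv_clm_apply hd (differentiableAt_const (EuclideanSpace.single j (1 : ℝ)))
    rwa [fderiv_fun_const, Pi.zero_apply, ContinuousLinearMap.comp_zero, zero_add] at h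
  rw [iteratedFDeriv_two_apply, partialDeriv, h]
  simp

theorem memLp_test (φ : 𝓓(Ω, ℂ)) (p : ℝ≥0∞) : MemLpOn Ω p φ :=
  MemLp.restrict (Ω : Set (Space N))
    (φ.continuous.memLp_of_hasCompactSupport φ.hasCompactSupport)

theorem memLp_partialDeriv_test (j : Fin N) (φ : 𝓓(Ω, ℂ)) (p : ℝ≥0∞) :
    MemLpOn Ω p (partialDeriv j φ) := by
  simpa only [coe_partialTest] using memLp_test (partialTest j φ) p

theorem integrable_mul_test {f : Space N → ℂ} (hf : LocallyIntegrableOn f Ω) (φ : 𝓓(Ω, ℂ)) :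
    Integrable (fun x => f x * φ x) (volume.restrict Ω) := by
  simpa only [ContinuousLinearMap.mul_apply', mul_comm] using
    (φ.integrable_bilin (ContinuousLinearMap.mul ℝ ℂ) hf).restrict (s := Ω)

end TestFunctions

section SobolevGradient

/-- `G` is the gradient of `u ∈ H^1_0(Ω)`: some sequence of test functions converges to `u` in
`L²(Ω)` while its gradients converge to `G` in `L²(Ω)`. -/
structure IsH10Gradient (Ω : Opens (Space N)) (u : Space N → ℂ) (G : Fin N → Space N → ℂ) :
    Prop where
  memLp : MemLpOn Ω 2 u
  memLp_grad : ∀ j, MemLpOn Ω 2 (G j)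
  exists_seq : ∃ φ : ℕ → 𝓓(Ω, ℂ),
    Tendsto (fun n => normLpOn Ω 2 (fun x => u x - φ n x)) atTop (𝓝 0) ∧
      ∀ j, Tendsto (fun n => normLpOn Ω 2 (fun x => G j x - partialDeriv j (φ n) x)) atTop (𝓝 0)

theorem MemH10.exists_isH10Gradient {u : Space N → ℂ} (hu : MemH10 Ω u) :
    ∃ G : Fin N → Space N → ℂ, IsH10Gradient Ω u G ∧ ∀ j, HasWeakPartial Ω j u (G j) := by
  obtain ⟨hu2, G, hG, happrox⟩ := hu
  choose φ hφ hφG using fun n : ℕ => happrox (1 / ((n : ℝ) + 1)) Nat.one_div_pos_of_nat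
  have h0 := tendsto_one_div_add_atTop_nhds_zero_nat (𝕜 := ℝ)
  exact ⟨G, ⟨hu2, fun j => (hG j).1, φ, squeeze_zero (fun n => lpNorm_nonneg) hφ h0,
    fun j => squeeze_zero (fun n => lpNorm_nonneg) (fun n => hφG n j) h0⟩, fun j => (hG j).2⟩

theorem tendsto_normLpOn_sub_sub {f₁ f₂ : Space N → ℂ} {g₁ g₂ : ℕ → Space N → ℂ}
    (hf₁ : MemLpOn Ω 2 f₁) (hg₁ : ∀ n, MemLpOn Ω 2 (g₁ n))
    (h₁ : Tendsto (fun n => normLpOn Ω 2 (fun x => f₁ x - g₁ n x)) atTop (𝓝 0))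
    (h₂ : Tendsto (fun n => normLpOn Ω 2 (fun x => f₂ x - g₂ n x)) atTop (𝓝 0)) :
    Tendsto (fun n => normLpOn Ω 2 (fun x => f₁ x - f₂ x - (g₁ n x - g₂ n x))) atTop (𝓝 0) := by
  refine squeeze_zero (fun n => lpNorm_nonneg) (fun n => ?_)
    (by simpa only [add_zero] using h₁.add h₂)
  have hsub := lpNorm_sub_le (g := fun x => f₂ x - g₂ n x) (hf₁.sub (hg₁ n)) (by norm_num)
  refine (congrArg (normLpOn Ω 2) (funext fun x => ?_)).trans_le hsub
  exact sub_sub_sub_comm _ _ _ _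

theorem IsH10Gradient.sub {u₁ u₂ : Space N → ℂ} {G₁ G₂ : Fin N → Space N → ℂ}
    (h₁ : IsH10Gradient Ω u₁ G₁) (h₂ : IsH10Gradient Ω u₂ G₂) :
    IsH10Gradient Ω (fun x => u₁ x - u₂ x) (fun j x => G₁ j x - G₂ j x) := by
  obtain ⟨φ₁, hφ₁, hφG₁⟩ := h₁.exists_seq
  obtain ⟨φ₂, hφ₂, hφG₂⟩ := h₂.exists_seq
  refine ⟨h₁.memLp.sub h₂.memLp, fun j => (h₁.memLp_grad j).sub (h₂.memLp_grad j),
    fun n => φ₁ n - φ₂ n, ?_, fun j => ?_⟩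
  · exact tendsto_normLpOn_sub_sub h₁.memLp (fun n => memLp_test (φ₁ n) 2) hφ₁ hφ₂
  · simp only [partialDeriv_sub_test]
    exact tendsto_normLpOn_sub_sub (h₁.memLp_grad j)
      (fun n => memLp_partialDeriv_test j (φ₁ n) 2) (hφG₁ j) (hφG₂ j)

end SobolevGradient

section WeakDivergence

/-- `k` is the weak divergence of the vector field `G` in `Ω`. -/
def HasWeakDivergence (Ω : Opens (Space N)) (G : Fin N → Space N → ℂ) (k : Space N → ℂ) : Prop :=
  ∀ φ : 𝓓(Ω, ℂ), ∑ j, ∫ x in Ω, G j x * partialDeriv j φ x = -∫ x in Ω, k x * φ x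

variable {u k : Space N → ℂ} {G H : Fin N → Space N → ℂ}

theorem HasWeakDivergence.sub {k₁ k₂ : Space N → ℂ} {G₁ G₂ : Fin N → Space N → ℂ}
    (h₁ : HasWeakDivergence Ω G₁ k₁) (h₂ : HasWeakDivergence Ω G₂ k₂)
    (hG₁ : ∀ j, MemLpOn Ω 2 (G₁ j)) (hG₂ : ∀ j, MemLpOn Ω 2 (G₂ j))
    (hk₁ : LocallyIntegrableOn k₁ Ω) (hk₂ : LocallyIntegrableOn k₂ Ω) :
    HasWeakDivergence Ω (fun j x => G₁ j x - G₂ j x) (fun x => k₁ x - k₂ x) := by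
  intro φ
  have hgrad (j : Fin N) : ∫ x in Ω, (G₁ j x - G₂ j x) * partialDeriv j φ x =
      (∫ x in Ω, G₁ j x * partialDeriv j φ x) - ∫ x in Ω, G₂ j x * partialDeriv j φ x := by
    simp only [sub_mul]
    exact integral_sub (integrable_mul_of_memLp_two (hG₁ j) (memLp_partialDeriv_test j φ 2))
      (integrable_mul_of_memLp_two (hG₂ j) (memLp_partialDeriv_test j φ 2))
  simp only [hgrad, Finset.sum_sub_distrib]
  simp only [sub_mul]
  rw [h₁ φ, h₂ φ, integral_sub (integrable_mul_test hk₁ φ) (integrable_mul_test hk₂ φ)]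
  ring

theorem HasWeakDivergence.smul (h : HasWeakDivergence Ω G k) (hG : ∀ j, MemLpOn Ω 2 (G j))
    (hk : LocallyIntegrableOn k Ω) {χ : Space N → ℝ} (hχ : ContDiff ℝ ∞ χ) :
    HasWeakDivergence Ω (fun j x => χ x • G j x)
      (fun x => χ x • k x + ∑ j, fderiv ℝ χ x (EuclideanSpace.single j 1) • G j x) := by
  intro φ
  have hdχ (j : Fin N) : ContDiff ℝ ∞ fun x => fderiv ℝ χ x (EuclideanSpace.single j 1) :=
    (hχ.fderiv_right (m := ∞) (by simp)).clm_apply contDiff_const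
  have hGdχ (j : Fin N) : Integrable
      (fun x => fderiv ℝ χ x (EuclideanSpace.single j 1) • G j x * φ x) (volume.restrict Ω) := by
    simpa only [coe_smulTest, mul_smul_comm, smul_mul_assoc] using
      integrable_mul_of_memLp_two (hG j) (memLp_test (smulTest _ (hdχ j) φ) 2)
  have hkχ : Integrable (fun x => χ x • k x * φ x) (volume.restrict Ω) := by
    simpa only [coe_smulTest, mul_smul_comm, smul_mul_assoc] using
      integrable_mul_test hk (smulTest χ hχ φ)
  have hleibniz (j : Fin N) : ∫ x in Ω, χ x • G j x * partialDeriv j φ x =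
      (∫ x in Ω, G j x * partialDeriv j (smulTest χ hχ φ) x) -
        ∫ x in Ω, fderiv ℝ χ x (EuclideanSpace.single j 1) • G j x * φ x := by
    rw [← integral_sub
      (integrable_mul_of_memLp_two (hG j) (memLp_partialDeriv_test j _ 2)) (hGdχ j)]
    congr 1 with x
    rw [coe_smulTest, partialDeriv_smul j (hχ.differentiable (by simp) x)
      (φ.contDiff.differentiable (by simp) x)]
    simp only [mul_add, mul_smul_comm, smul_mul_assoc, add_sub_cancel_right]
  simp only [hleibniz, Finset.sum_sub_distrib, h (smulTest χ hχ φ), add_mul, Finset.sum_mul]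
  rw [integral_add hkχ (integrable_finsetSum _ fun j _ => hGdχ j),
    integral_finsetSum _ fun j _ => hGdχ j]
  simp only [coe_smulTest, mul_smul_comm, smul_mul_assoc]
  ring

theorem HasWeakDivergence.sum_integral_mul_conj_eq (h : HasWeakDivergence Ω G k)
    (hG : ∀ j, MemLpOn Ω 2 (G j)) (hk : MemLpOn Ω 2 k) (hu : IsH10Gradient Ω u H) :
    ∑ j, ∫ x in Ω, G j x * conj (H j x) = -∫ x in Ω, k x * conj (u x) := by
  obtain ⟨φ, hφ, hφH⟩ := hu.exists_seq
  have hgrad := tendsto_finsetSum Finset.univ fun j _ => tendsto_integral_mul_conj (hG j)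
    (hu.memLp_grad j) (fun n => memLp_partialDeriv_test j (φ n) 2) (hφH j)
  have hdiv := (tendsto_integral_mul_conj hk hu.memLp (fun n => memLp_test (φ n) 2) hφ).neg
  refine tendsto_nhds_unique (hgrad.congr fun n => ?_) hdiv
  simpa only [coe_conjTest, partialDeriv_conj] using h (conjTest (φ n))

end WeakDivergence

section LocalIntegrability

variable {p : ℝ≥0∞} {f g : Space N → ℂ}

theorem MemLpLocOn.locallyIntegrableOn (hp : 1 ≤ p) (hf : MemLpLocOn Ω p f) :
    LocallyIntegrableOn f Ω := by
  refine (locallyIntegrableOn_iff Ω.isOpen.isLocallyClosed).2 fun Q hQΩ hQ => ?_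
  have : IsFiniteMeasure (volume.restrict Q) := ⟨by simpa using hQ.measure_lt_top⟩
  exact (hf Q hQ hQΩ).integrable hp

/-- `f ∈ L^p(Ω ∩ Q)` for every compact `Q`. In contrast to `MemLpLocOn`, the set `Q` may reach the
boundary of `Ω`. -/
def MemLpLocUpToBoundary (Ω : Opens (Space N)) (p : ℝ≥0∞) (f : Space N → ℂ) : Prop :=
  ∀ Q : Set (Space N), IsCompact Q → MemLp f p ((volume.restrict (Ω : Set (Space N))).restrict Q)

theorem MemLpOn.memLpLocUpToBoundary (hf : MemLpOn Ω p f) : MemLpLocUpToBoundary Ω p f :=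
  fun Q _ => MemLp.restrict Q hf

theorem MemLpLocUpToBoundary.locallyIntegrableOn (hp : 1 ≤ p)
    (hf : MemLpLocUpToBoundary Ω p f) : LocallyIntegrableOn f Ω := by
  refine MemLpLocOn.locallyIntegrableOn hp fun Q hQ hQΩ => ?_
  simpa only [Measure.restrict_restrict hQ.measurableSet, Set.inter_eq_left.2 hQΩ] using hf Q hQ

theorem MemLpLocUpToBoundary.sub (hf : MemLpLocUpToBoundary Ω p f)
    (hg : MemLpLocUpToBoundary Ω p g) : MemLpLocUpToBoundary Ω p (fun x => f x - g x) :=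
  fun Q hQ => (hf Q hQ).sub (hg Q hQ)

theorem MemLpLocUpToBoundary.const_mul (hf : MemLpLocUpToBoundary Ω p f) (c : ℂ) :
    MemLpLocUpToBoundary Ω p (fun x => c * f x) :=
  fun Q hQ => (hf Q hQ).const_mul c

theorem MemLpLocUpToBoundary.memLpOn_smul (hf : MemLpLocUpToBoundary Ω p f) {χ : Space N → ℝ}
    (hχ : Continuous χ) (hχc : HasCompactSupport χ) : MemLpOn Ω p (fun x => χ x • f x) :=
  memLp_smul_of_restrict_tsupport hχ hχc (hf _ hχc)

theorem memLpLocUpToBoundary_zeroOrder {m : ℝ} (hm0 : 0 ≤ m) (hm1 : m ≤ 1) (a b : ℂ)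
    (hf : MemLpOn Ω p f) :
    MemLpLocUpToBoundary Ω p (fun x => a * singularPower m (f x) + b * f x) := by
  intro Q hQ
  have : IsFiniteMeasure ((volume.restrict (Ω : Set (Space N))).restrict Q) :=
    ⟨by simpa using hQ.measure_lt_top⟩
  have hfQ := hf.memLpLocUpToBoundary Q hQ
  exact ((memLp_singularPower hm0 hm1 hfQ).const_mul a).add (hfQ.const_mul b)

end LocalIntegrability

section Energy

variable {u k F K : Space N → ℂ} {G : Fin N → Space N → ℂ} {w : Space N → ℝ}

theorem IsH10Gradient.sum_integral_cutoff_eq (hu : IsH10Gradient Ω u G)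
    (h : HasWeakDivergence Ω G k) (hk : MemLpLocUpToBoundary Ω 2 k) {χ : Space N → ℝ}
    (hχ : ContDiff ℝ ∞ χ) (hχc : HasCompactSupport χ) :
    ((∑ j, ∫ x in Ω, χ x * ‖G j x‖ ^ 2 : ℝ) : ℂ) = -(∫ x in Ω, χ x • (k x * conj (u x))) -
      ∑ j, ∫ x in Ω, fderiv ℝ χ x (EuclideanSpace.single j 1) • (G j x * conj (u x)) := by
  have hkχ := hk.memLpOn_smul hχ.continuous hχc
  have hGχ (j : Fin N) := (hu.memLp_grad j).memLpLocUpToBoundary.memLpOn_smul hχ.continuous hχc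
  have hGdχ (j : Fin N) := (hu.memLp_grad j).memLpLocUpToBoundary.memLpOn_smul
    ((hχ.continuous_fderiv (by simp)).clm_apply continuous_const)
    (hχc.fderiv_apply ℝ (EuclideanSpace.single j 1))
  have hcut := h.smul hu.memLp_grad (hk.locallyIntegrableOn one_le_two) hχ
  have henergy := hcut.sum_integral_mul_conj_eq hGχ
    (hkχ.add (memLp_finsetSum _ fun j _ => hGdχ j)) hu
  simp only [add_mul, Finset.sum_mul] at henergy
  rw [integral_add (integrable_mul_conj hkχ hu.memLp)
    (integrable_finsetSum _ fun j _ => integrable_mul_conj (hGdχ j) hu.memLp),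
    integral_finsetSum _ fun j _ => integrable_mul_conj (hGdχ j) hu.memLp, neg_add'] at henergy
  simp only [smul_mul_assoc, Complex.mul_conj'] at henergy
  rw [← henergy]
  push_cast [← integral_complex_ofReal]
  rfl

theorem IsH10Gradient.integral_cutoff_le {c : ℂ} (hu : IsH10Gradient Ω u G)
    (h : HasWeakDivergence Ω G k) (hk : MemLpLocUpToBoundary Ω 2 k) (hc : 0 ≤ c.re)
    (hw : Integrable w (volume.restrict Ω))
    (hle : ∀ᵐ x ∂volume.restrict (Ω : Set (Space N)), w x ≤ (c * (k x * conj (u x))).re)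
    {χ : Space N → ℝ} (hχ : ContDiff ℝ ∞ χ) (hχc : HasCompactSupport χ)
    (hχ01 : ∀ x, χ x ∈ Set.Icc 0 1) :
    ∫ x in Ω, χ x • w x ≤ (-(c * ∑ j, ∫ x in Ω,
      fderiv ℝ χ x (EuclideanSpace.single j 1) • (G j x * conj (u x)))).re := by
  have hkint : Integrable (fun x => χ x • (k x * conj (u x))) (volume.restrict Ω) := by
    simpa only [smul_mul_assoc] using
      integrable_mul_conj (hk.memLpOn_smul hχ.continuous hχc) hu.memLp
  have hforcing : ∫ x in Ω, χ x • w x ≤ (c * ∫ x in Ω, χ x • (k x * conj (u x))).re := by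
    rw [← integral_const_mul]
    refine (integral_mono_ae ?_ (hkint.const_mul c).re ?_).trans_eq
      (integral_re (hkint.const_mul c))
    · exact hw.bdd_smul 1 hχ.continuous.aestronglyMeasurable
        (ae_of_all _ fun x => abs_le.2 ⟨by linarith [(hχ01 x).1], (hχ01 x).2⟩)
    · filter_upwards [hle] with x hx
      rw [mul_smul_comm]
      simpa using mul_le_mul_of_nonneg_left hx (hχ01 x).1
  have hgrad : 0 ≤ (c * ((∑ j, ∫ x in Ω, χ x * ‖G j x‖ ^ 2 : ℝ) : ℂ)).re := by
    rw [Complex.re_mul_ofReal]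
    exact mul_nonneg hc (Finset.sum_nonneg fun j _ => integral_nonneg fun x =>
      mul_nonneg (hχ01 x).1 (sq_nonneg _))
  rw [hu.sum_integral_cutoff_eq h hk hχ hχc, mul_sub, mul_neg, Complex.sub_re,
    Complex.neg_re] at hgrad
  rw [Complex.neg_re]
  linarith

theorem IsH10Gradient.integral_nonpos {c : ℂ} (hu : IsH10Gradient Ω u G)
    (h : HasWeakDivergence Ω G k) (hk : MemLpLocUpToBoundary Ω 2 k) (hc : 0 ≤ c.re)
    (hw : Integrable w (volume.restrict Ω))
    (hle : ∀ᵐ x ∂volume.restrict (Ω : Set (Space N)), w x ≤ (c * (k x * conj (u x))).re) :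
    ∫ x in Ω, w x ≤ 0 := by
  obtain ⟨χ, C, hχ, hχc, hχ01, hC, hlim⟩ := exists_cutoff_seq (Space N)
  have hdχ (n : ℕ) (j : Fin N) :
      Continuous fun x => fderiv ℝ (χ n) x (EuclideanSpace.single j 1) :=
    ((hχ n).continuous_fderiv (by simp)).clm_apply continuous_const
  have hmain : Tendsto (fun n => ∫ x in Ω, χ n x • w x) atTop
      (𝓝 ((1 : ℝ) • ∫ x in Ω, w x)) :=
    tendsto_integral_smul_of_tendsto hw (fun n => (hχ n).continuous.aestronglyMeasurable)
      (fun n x => abs_le.2 ⟨by linarith [(hχ01 n x).1], (hχ01 n x).2⟩)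
      fun x => tendsto_nhds_of_eventually_eq ((hlim x).mono fun n hn => hn.self_of_nhds)
  have herror (j : Fin N) : Tendsto (fun n => ∫ x in Ω,
      fderiv ℝ (χ n) x (EuclideanSpace.single j 1) • (G j x * conj (u x))) atTop
      (𝓝 ((0 : ℝ) • ∫ x in Ω, G j x * conj (u x))) := by
    refine tendsto_integral_smul_of_tendsto (integrable_mul_conj (hu.memLp_grad j) hu.memLp)
      (fun n => (hdχ n j).aestronglyMeasurable) (C := C) (fun n x => ?_) fun x => ?_
    · simpa using (fderiv ℝ (χ n) x).le_of_opNorm_le (hC n x) (EuclideanSpace.single j 1)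
    · refine tendsto_nhds_of_eventually_eq ((hlim x).mono fun n hn => ?_)
      simp [hn.fderiv_eq]
  have hbound := (Complex.continuous_re.tendsto _).comp
    ((tendsto_finsetSum Finset.univ fun j _ => herror j).const_mul c).neg
  simpa using le_of_tendsto_of_tendsto' hmain hbound fun n =>
    hu.integral_cutoff_le h hk hc hw hle (hχ n) (hχc n) (hχ01 n)

theorem IsH10Gradient.mul_normLpOn_le {c : ℂ} {δ : ℝ} (hu : IsH10Gradient Ω u G)
    (h : HasWeakDivergence Ω G (fun x => Complex.I * (F x - K x))) (hF : MemLpOn Ω 2 F)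
    (hK : MemLpLocUpToBoundary Ω 2 K) (hc : c.im ≤ 0)
    (hδ : ∀ᵐ x ∂volume.restrict (Ω : Set (Space N)),
      δ * ‖u x‖ ^ 2 ≤ (c * (K x * conj (u x))).re) :
    δ * normLpOn Ω 2 u ≤ ‖c‖ * normLpOn Ω 2 F := by
  have hsq : Integrable (fun x => δ * ‖u x‖ ^ 2) (volume.restrict Ω) :=
    hu.memLp.norm.integrable_sq.const_mul δ
  have hFu : Integrable (fun x => c * (F x * conj (u x))) (volume.restrict Ω) :=
    (integrable_mul_conj hF hu.memLp).const_mul c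
  have henergy : ∫ x in Ω, (δ * ‖u x‖ ^ 2 - (c * (F x * conj (u x))).re) ≤ 0 := by
    refine hu.integral_nonpos (c := c * Complex.I) h
      ((hF.memLpLocUpToBoundary.sub hK).const_mul Complex.I) (by simpa using hc)
      (hsq.sub hFu.re) ?_
    filter_upwards [hδ] with x hx
    have hrot : c * Complex.I * (Complex.I * (F x - K x) * conj (u x)) =
        c * (K x * conj (u x)) - c * (F x * conj (u x)) := by
      linear_combination (c * (F x - K x) * conj (u x)) * Complex.I_mul_I
    rw [hrot, Complex.sub_re]
    exact sub_le_sub_right hx _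
  have hre : ∫ x in Ω, (c * (F x * conj (u x))).re = (c * ∫ x in Ω, F x * conj (u x)).re := by
    rw [← integral_const_mul]
    exact integral_re hFu
  rw [integral_sub hsq (by exact hFu.re), integral_const_mul,
    integral_norm_sq_eq_lpNorm_sq hu.memLp, hre, sub_nonpos] at henergy
  have hcauchy : (c * ∫ x in Ω, F x * conj (u x)).re ≤
      ‖c‖ * (normLpOn Ω 2 F * normLpOn Ω 2 u) := by
    refine (Complex.re_le_norm _).trans ?_
    rw [norm_mul]
    exact mul_le_mul_of_nonneg_left (norm_integral_mul_conj_le hF hu.memLp) (norm_nonneg c)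
  change δ * normLpOn Ω 2 u ^ 2 ≤ _ at henergy
  have hnonneg : 0 ≤ normLpOn Ω 2 u := lpNorm_nonneg
  rcases hnonneg.eq_or_lt with hzero | hpos
  · rw [← hzero, mul_zero]
    exact mul_nonneg (norm_nonneg c) lpNorm_nonneg
  · exact le_of_mul_le_mul_right (by linarith) hpos

end Energy

section WeakSolutions

variable {m : ℝ} {a b : ℂ} {F u : Space N → ℂ} {G : Fin N → Space N → ℂ}

/-- The Laplacian as an operator on test functions. -/
noncomputable def laplacianTest : 𝓓(Ω, ℂ) →L[ℂ] 𝓓(Ω, ℂ) :=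
  ∑ j, partialTest j ∘L partialTest j

theorem coe_laplacianTest (φ : 𝓓(Ω, ℂ)) :
    ⇑(laplacianTest φ) = Laplacian.laplacian (φ : Space N → ℂ) := by
  ext x
  rw [laplacian_eq_sum_partialDeriv (contDiff_infty.1 φ.contDiff 2)]
  simp [laplacianTest]

theorem laplacian_conj (f : Space N → ℂ) (x : Space N) :
    Laplacian.laplacian (fun y => conj (f y)) x = conj (Laplacian.laplacian f x) :=
  congrFun (InnerProductSpace.laplacian_CLE_comp_left (f := f) (l := Complex.conjCLE)) x

theorem integral_mul_laplacianTest (hu : LocallyIntegrableOn u Ω)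
    (hG : ∀ j, HasWeakPartial Ω j u (G j)) (φ : 𝓓(Ω, ℂ)) :
    ∫ x in Ω, u x * laplacianTest φ x = -∑ j, ∫ x in Ω, G j x * partialDeriv j φ x := by
  have hsum (x : Space N) :
      u x * laplacianTest φ x = ∑ j, u x * partialTest j (partialTest j φ) x := by
    simp [laplacianTest, Finset.mul_sum]
  simp only [hsum]
  rw [integral_finsetSum _ fun j _ => integrable_mul_test hu _, ← Finset.sum_neg_distrib]
  exact Finset.sum_congr rfl fun j _ => by simpa only [coe_partialTest] using hG j (partialTest j φ)

theorem IsLocalWeakSolution.re_weakForm_eq_zero (h : IsLocalWeakSolution Ω m a b F u)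
    (hF : LocallyIntegrableOn F Ω) (hu : LocallyIntegrableOn u Ω)
    (hK : LocallyIntegrableOn (fun x => a * singularPower m (u x) + b * u x) Ω)
    (hG : ∀ j, HasWeakPartial Ω j u (G j)) (φ : 𝓓(Ω, ℂ)) :
    (Complex.I * (∑ j, ∫ x in Ω, G j x * partialDeriv j φ x) +
      ∫ x in Ω, (a * singularPower m (u x) + b * u x - F x) * φ x).re = 0 := by
  have hweak := h.2 (conjTest φ)
  simp only [laplacian_conj, coe_conjTest, Complex.conj_conj, ← coe_laplacianTest,
    mul_assoc (-Complex.I)] at hweak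
  rw [integral_add ((integrable_mul_test hu _).const_mul _) (integrable_mul_test hK φ),
    integral_const_mul, integral_mul_laplacianTest hu hG, neg_mul_neg] at hweak
  simp only [sub_mul]
  rw [integral_sub (integrable_mul_test hK φ) (integrable_mul_test hF φ), ← add_sub_assoc,
    Complex.sub_re, sub_eq_zero]
  exact hweak

theorem IsLocalWeakSolution.hasWeakDivergence (h : IsLocalWeakSolution Ω m a b F u)
    (hF : LocallyIntegrableOn F Ω) (hu : LocallyIntegrableOn u Ω)
    (hK : LocallyIntegrableOn (fun x => a * singularPower m (u x) + b * u x) Ω)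
    (hG : ∀ j, HasWeakPartial Ω j u (G j)) :
    HasWeakDivergence Ω G
      (fun x => Complex.I * (F x - (a * singularPower m (u x) + b * u x))) := by
  intro φ
  have hre := h.re_weakForm_eq_zero hF hu hK hG φ
  -- Testing with `I • φ` turns the real part of the pairing into its imaginary part.
  have him := h.re_weakForm_eq_zero hF hu hK hG (Complex.I • φ)
  simp only [partialDeriv_const_smul_test, smul_apply, smul_eq_mul, mul_left_comm _ Complex.I,
    integral_const_mul, ← Finset.mul_sum] at him
  rw [← mul_add, Complex.I_mul_re, neg_eq_zero] at him
  have hzero := Complex.ext (w := 0) hre him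
  have hneg : ∫ x in Ω, Complex.I * (F x - (a * singularPower m (u x) + b * u x)) * φ x =
      -(Complex.I * ∫ x in Ω, (a * singularPower m (u x) + b * u x - F x) * φ x) := by
    rw [← integral_const_mul, ← integral_neg]
    congr 1 with x
    ring
  rw [hneg]
  linear_combination -Complex.I * hzero +
    (∑ j, ∫ x in Ω, G j x * partialDeriv j φ x) * Complex.I_mul_I

end WeakSolutions

section Uniqueness

variable {m : ℝ} {a b c : ℂ} {δ : ℝ} {F₁ F₂ u₁ u₂ : Space N → ℂ}

theorem IsLocalWeakSolution.mul_normLpOn_sub_le (hm0 : 0 ≤ m) (hm1 : m ≤ 1)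
    (h₁ : IsLocalWeakSolution Ω m a b F₁ u₁) (h₂ : IsLocalWeakSolution Ω m a b F₂ u₂)
    (hu₁ : MemH10 Ω u₁) (hu₂ : MemH10 Ω u₂) (hF₁ : MemLpLocOn Ω 1 F₁)
    (hF₂ : MemLpLocOn Ω 1 F₂) (hF : MemLpOn Ω 2 (fun x => F₁ x - F₂ x)) (hc : c.im ≤ 0)
    (hδ : ∀ᵐ x ∂volume.restrict (Ω : Set (Space N)), δ * ‖u₁ x - u₂ x‖ ^ 2 ≤
      (c * ((a * (singularPower m (u₁ x) - singularPower m (u₂ x)) + b * (u₁ x - u₂ x)) *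
        conj (u₁ x - u₂ x))).re) :
    δ * normLpOn Ω 2 (fun x => u₁ x - u₂ x) ≤ ‖c‖ * normLpOn Ω 2 (fun x => F₁ x - F₂ x) := by
  obtain ⟨G₁, hG₁, hw₁⟩ := hu₁.exists_isH10Gradient
  obtain ⟨G₂, hG₂, hw₂⟩ := hu₂.exists_isH10Gradient
  have hK₁ := memLpLocUpToBoundary_zeroOrder hm0 hm1 a b hu₁.1
  have hK₂ := memLpLocUpToBoundary_zeroOrder hm0 hm1 a b hu₂.1
  have hK₁loc := hK₁.locallyIntegrableOn one_le_two
  have hK₂loc := hK₂.locallyIntegrableOn one_le_two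
  have hF₁loc := hF₁.locallyIntegrableOn le_rfl
  have hF₂loc := hF₂.locallyIntegrableOn le_rfl
  have hdiv := (h₁.hasWeakDivergence hF₁loc
      (hu₁.1.memLpLocUpToBoundary.locallyIntegrableOn one_le_two) hK₁loc hw₁).sub
    (h₂.hasWeakDivergence hF₂loc
      (hu₂.1.memLpLocUpToBoundary.locallyIntegrableOn one_le_two) hK₂loc hw₂)
    hG₁.memLp_grad hG₂.memLp_grad ((hF₁loc.sub hK₁loc).smul Complex.I)
    ((hF₂loc.sub hK₂loc).smul Complex.I)
  have hdiff : (fun x => Complex.I * (F₁ x - (a * singularPower m (u₁ x) + b * u₁ x)) -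
      Complex.I * (F₂ x - (a * singularPower m (u₂ x) + b * u₂ x))) = fun x => Complex.I *
        (F₁ x - F₂ x - (a * singularPower m (u₁ x) + b * u₁ x -
          (a * singularPower m (u₂ x) + b * u₂ x))) := by
    funext x
    ring
  rw [hdiff] at hdiv
  refine (hG₁.sub hG₂).mul_normLpOn_le hdiv hF (hK₁.sub hK₂) hc (hδ.mono fun x hx => ?_)
  convert hx using 4
  ring

theorem re_conj_mul_zeroOrder (a b s w : ℂ) :
    (conj a * ((a * s + b * w) * conj w)).re =
      ‖a‖ ^ 2 * (s * conj w).re + (a * conj b).re * ‖w‖ ^ 2 := by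
  simp only [Complex.sq_norm, Complex.normSq_apply, Complex.mul_re, Complex.mul_im, Complex.add_re,
    Complex.add_im, Complex.conj_re, Complex.conj_im]
  ring

theorem re_mul_norm_sub_sq_le (hm0 : 0 < m) (hm1 : m ≤ 1) (a b z w : ℂ) :
    (a * conj b).re * ‖z - w‖ ^ 2 ≤ (conj a *
      ((a * (singularPower m z - singularPower m w) + b * (z - w)) * conj (z - w))).re := by
  rw [re_conj_mul_zeroOrder]
  exact le_add_of_nonneg_left
    (mul_nonneg (sq_nonneg _) (re_singularPower_sub_mul_conj_nonneg hm0 hm1 z w))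

theorem mul_norm_sub_sq_le_of_norm_add_norm_le {M : ℝ} {z w : ℂ} (hm0 : 0 < m) (hm1 : m ≤ 1)
    (hab : (a * conj b).re = 0) (hM : ‖z‖ + ‖w‖ ≤ M) :
    ‖a‖ ^ 2 * m * ‖z - w‖ ^ 2 ≤ (((M ^ (1 - m) : ℝ) : ℂ) * conj a *
      ((a * (singularPower m z - singularPower m w) + b * (z - w)) * conj (z - w))).re := by
  rw [mul_assoc _ (conj a), Complex.re_ofReal_mul, re_conj_mul_zeroOrder, hab, zero_mul, add_zero,
    mul_left_comm, mul_assoc]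
  refine mul_le_mul_of_nonneg_left ((mul_norm_sub_sq_le_singularPower hm0 hm1 z w).trans ?_)
    (sq_nonneg _)
  exact mul_le_mul_of_nonneg_right
    (Real.rpow_le_rpow (by positivity) hM (sub_nonneg.2 hm1))
    (re_singularPower_sub_mul_conj_nonneg hm0 hm1 z w)

theorem bZero_pos_of_mem_setA (hb : b ∈ setA) : 0 < bZero b := by
  rw [bZero]
  split_ifs with hre
  · exact abs_pos.2 hre
  · exact not_le.1 fun him => hb ⟨not_not.1 hre, him⟩

theorem exists_norm_eq_one_re_mul_eq_bZero (b : ℂ) :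
    ∃ c : ℂ, ‖c‖ = 1 ∧ c.im ≤ 0 ∧ (c * b).re = bZero b := by
  rcases lt_trichotomy b.re 0 with hre | hre | hre
  · exact ⟨-1, by simp, by simp, by simp [bZero, hre.ne, abs_of_neg hre]⟩
  · exact ⟨-Complex.I, by simp, by simp, by simp [bZero, hre]⟩
  · exact ⟨1, by simp, by simp, by simp [bZero, hre.ne', abs_of_pos hre]⟩

theorem UniquenessAssumption.mem_setA (hab : UniquenessAssumption 0 b) (hb : b ≠ 0) : b ∈ setA :=
  (hab.2.resolve_left fun h => h.1 rfl).2.resolve_right hb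

end Uniqueness

theorem theorem5p1_general {N : ℕ} {Ω : Opens (Space N)} {m : ℝ} {a b : ℂ}
    {F₁ F₂ u₁ u₂ : Space N → ℂ} (hm0 : 0 < m) (hm1 : m ≤ 1) (hab0 : (a, b) ≠ (0, 0))
    (hab : UniquenessAssumption a b) (hF₁ : MemLpLocOn Ω 1 F₁) (hF₂ : MemLpLocOn Ω 1 F₂)
    (hF : MemLpOn Ω 2 (fun x => F₁ x - F₂ x)) (hu₁ : MemH10 Ω u₁) (hu₂ : MemH10 Ω u₂)
    (h₁ : IsLocalWeakSolution Ω m a b F₁ u₁) (h₂ : IsLocalWeakSolution Ω m a b F₂ u₂) :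
    (a ≠ 0 → 0 < (a * conj b).re → normLpOn Ω 2 (fun x => u₁ x - u₂ x) ≤
        ‖a‖ / (a * conj b).re * normLpOn Ω 2 (fun x => F₁ x - F₂ x)) ∧
      (a = 0 → normLpOn Ω 2 (fun x => u₁ x - u₂ x) ≤
        1 / bZero b * normLpOn Ω 2 (fun x => F₁ x - F₂ x)) ∧
      (a ≠ 0 → (a * conj b).re = 0 → MemLpOn Ω ∞ u₁ → MemLpOn Ω ∞ u₂ →
        normLpOn Ω 2 (fun x => u₁ x - u₂ x) ≤
          1 / m * ((normLpOn Ω ∞ u₁ + normLpOn Ω ∞ u₂) ^ (1 - m) / ‖a‖) *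
            normLpOn Ω 2 (fun x => F₁ x - F₂ x)) := by
  have estimate {c : ℂ} {δ : ℝ} :=
    h₁.mul_normLpOn_sub_le (c := c) (δ := δ) hm0.le hm1 h₂ hu₁ hu₂ hF₁ hF₂ hF
  have hconj : (conj a).im ≤ 0 := by simpa using hab.1
  refine ⟨fun _ hpos => ?_, fun ha => ?_, fun ha hre hu₁top hu₂top => ?_⟩
  · have h := estimate hconj (ae_of_all _ fun x => re_mul_norm_sub_sq_le hm0 hm1 a b (u₁ x) (u₂ x))
    rwa [RCLike.norm_conj, mul_comm, ← le_div_iff₀ hpos, ← div_mul_eq_mul_div] at h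
  · subst ha
    have hpos := bZero_pos_of_mem_setA (hab.mem_setA fun hb => hab0 (by rw [hb]))
    obtain ⟨c, hc, hcim, hcb⟩ := exists_norm_eq_one_re_mul_eq_bZero b
    have h := estimate (δ := bZero b) hcim (ae_of_all _ fun x => le_of_eq (by
      rw [zero_mul, zero_add, mul_assoc b, Complex.mul_conj', ← mul_assoc, ← Complex.ofReal_pow,
        Complex.re_mul_ofReal, hcb]))
    rwa [hc, mul_comm, ← le_div_iff₀ hpos, ← div_mul_eq_mul_div] at h
  · have hM : 0 ≤ normLpOn Ω ∞ u₁ + normLpOn Ω ∞ u₂ := add_nonneg lpNorm_nonneg lpNorm_nonneg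
    set S := (normLpOn Ω ∞ u₁ + normLpOn Ω ∞ u₂) ^ (1 - m)
    have hS0 : 0 ≤ S := Real.rpow_nonneg hM _
    have h := estimate (c := (S : ℂ) * conj a) (δ := ‖a‖ ^ 2 * m)
      (by simpa using mul_nonneg hS0 hab.1) (by
        filter_upwards [ae_le_lpNorm_exponent_top hu₁top, ae_le_lpNorm_exponent_top hu₂top]
          with x hx₁ hx₂
        exact mul_norm_sub_sq_le_of_norm_add_norm_le hm0 hm1 hre (add_le_add hx₁ hx₂))
    have hδ : 0 < ‖a‖ ^ 2 * m := mul_pos (pow_pos (norm_pos_iff.2 ha) 2) hm0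
    rw [norm_mul, RCLike.norm_conj, Complex.norm_of_nonneg hS0] at h
    refine le_of_mul_le_mul_left (h.trans_eq ?_) hδ
    field_simp

end StationaryNLS

theorem theorem5p1 (N : ℕ) (hN : 1 ≤ N) :
    ∃ C : ℝ → ℝ, ContinuousOn C (Set.Ioo 0 1) ∧
      ∀ m : ℝ, 0 < m → m < 1 → 0 < C m ∧
        ∀ (Ω : TopologicalSpace.Opens (StationaryNLS.Space N)),
          (Ω : Set (StationaryNLS.Space N)).Nonempty →
        ∀ a b : ℂ, (a, b) ≠ (0, 0) → StationaryNLS.UniquenessAssumption a b →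
        ∀ F₁ F₂ : StationaryNLS.Space N → ℂ,
          StationaryNLS.MemLpLocOn Ω 1 F₁ → StationaryNLS.MemLpLocOn Ω 1 F₂ →
          StationaryNLS.MemLpOn Ω 2 (fun x => F₁ x - F₂ x) →
        ∀ u₁ u₂ : StationaryNLS.Space N → ℂ,
          StationaryNLS.IsGlobalWeakSolution Ω m a b F₁ u₁ →
          StationaryNLS.IsGlobalWeakSolution Ω m a b F₂ u₂ →
          (a ≠ 0 → 0 < (a * conj b).re →
            StationaryNLS.normLpOn Ω 2 (fun x => u₁ x - u₂ x) ≤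
              ‖a‖ / (a * conj b).re * StationaryNLS.normLpOn Ω 2 (fun x => F₁ x - F₂ x)) ∧
          (a = 0 →
            StationaryNLS.normLpOn Ω 2 (fun x => u₁ x - u₂ x) ≤
              1 / StationaryNLS.bZero b * StationaryNLS.normLpOn Ω 2 (fun x => F₁ x - F₂ x)) ∧
          (a ≠ 0 → (a * conj b).re = 0 →
            StationaryNLS.MemLpOn Ω ∞ u₁ → StationaryNLS.MemLpOn Ω ∞ u₂ →
            StationaryNLS.normLpOn Ω 2 (fun x => u₁ x - u₂ x) ≤
              C m *
                ((StationaryNLS.normLpOn Ω ∞ u₁ + StationaryNLS.normLpOn Ω ∞ u₂) ^ (1 - m) / ‖a‖) *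
                StationaryNLS.normLpOn Ω 2 (fun x => F₁ x - F₂ x)) := by
  refine ⟨fun m => 1 / m, continuousOn_const.div continuousOn_id fun m hm => hm.1.ne', ?_⟩
  intro m hm0 hm1
  exact ⟨one_div_pos.2 hm0, fun Ω _ a b hab0 hab F₁ F₂ hF₁ hF₂ hF u₁ u₂ h₁ h₂ =>
    StationaryNLS.theorem5p1_general hm0 hm1.le hab0 hab hF₁ hF₂ hF h₁.2.1 h₂.2.1 h₁.1 h₂.1⟩
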